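/- **Setting.** A *BB84-type protocol* $\Pi$ (a family indexed by the security parameter $n$) between Alice and Bob, possibly with a public classical common reference string (CRS) drawn beforehand from a fixed distribution, has two phases. *Preparation:* Alice chooses uniform $x\in\{0,1\}^n$ and $\theta\in\{+,\times\}^n$ and sends the $n$ qubits $|x\rangle_\theta$ to Bob; honest Bob measures them in uniformly random bases $\hat\theta$ and obtains $\hat x$. *Post-processing:* an arbitrary finite classical interaction with classical (randomised) local computation, in at least one round, in each of which Bob and then Alice sends a (possibly trivial) message; either party may abort, in which case Alice's output is $\bot$. An ideal functionality $\mathcal F$ is a conditional distribution of outputs $(X,Y)$, with $X$ possibly $\bot$, given an input $U$ of Alice and $V$ of (dishonest) Bob; all alphabets are finite. *Inputs.* An input state is $\rho_{UZV'}=\sum_{u,z}P_{UZ}(u,z)\,|u\rangle\langle u|\otimes|z\rangle\langle z|\otimes\rho^z_{V'}$, where $U$ is Alice's input, $Z$ is Bob's classical and $V'$ his quantum input; it does not depend on the CRS. *Real world:* honest Alice runs the protocol with a dishonest Bob $\mathsf B'$, who performs arbitrary quantum operations on his (classical and quantum) memory and outputs a quantum state $Y'$. *Ideal world:* $\hat{\mathsf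 B}'$ computes from $Z,V'$ a classical input $V$ for $\mathcal F$, receives the reply $Y$, and computes $Y'$ from what he kept, $V$ and $Y$. In both worlds the output is the joint state $\rho_{UXZY'}$. *BQSM security.* A point of the protocol, at the end of the preparation or verification phase or in the post-processing, is designated. For a protocol in which $N$ qubits are sent initially, a $\gamma$-*BQSM Bob* is a dishonest Bob who from this point on stores at most $\gamma N$ qubits (his classical storage and computing power are unbounded). The protocol implements $\mathcal F$ *unconditionally securely against $\gamma$-BQSM Bob* if for every $\gamma$-BQSM Bob $\mathsf B'$ there is an ideal-world adversary $\hat{\mathsf B}'$ such that for every family of input states the trace distance of the real and the ideal output states is negligible in the security parameter (eventually at most $n^{-c}$ for every $c$). *Compiler.* Let $0<\alpha<1$ and fix a keyed classical commitment scheme $\mathtt{commit}_{pk}(\cdot\,;r)$ for messages in $\{0,1\}^2$ (no hiding or binding property is needed below). The compiled protocol $\mathcal C^\alpha(\Pi)$ uses $m=n/(1-\alpha)$ qubits (rounded down to an integer), and a key $pk$ from the scheme's key distribution is part of its CRS. *Preparation:* as in $\Pi$, with $m$ qubits. *Verification:* Bob sends commitments $c_i=\mathtt{commit}_{pk}((\hat\theta_i,\hat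 x_i);r_i)$ for $i=1,\dots,m$; Alice sends a uniformly random test set $T\subset\{1,\dots,m\}$ of size $m-n$ (i.e. $\alpha m$, up to rounding); Bob opens $c_i$ for all $i\in T$; Alice checks that the openings are correct and that $x_i=\hat x_i$ whenever $i\in T$ and $\theta_i=\hat\theta_i$, and aborts if this fails. *Post-processing:* as in $\Pi$, with $x,\theta,\hat x,\hat\theta$ restricted to the $n$ positions outside $T$. The designated point of $\mathcal C^\alpha(\Pi)$ is that of $\Pi$ (the end of the verification phase, if it is the end of the preparation phase in $\Pi$). **Theorem.** Let $0<\gamma<1$ and $0<\alpha<1$ be constants and let $\Pi$ be a BB84-type protocol. If $\Pi$ implements $\mathcal F$ unconditionally securely against $\gamma$-BQSM Bob, then $\mathcal C^\alpha(\Pi)$ implements $\mathcal F$ unconditionally securely against $\gamma(1-\alpha)$-BQSM Bob (who stores at most $\gamma(1-\alpha)m$ qubits). -/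

import Mathlib

open scoped Matrix BigOperators ComplexOrder

noncomputable section

namespace BQSM

/-! ### Quantum registers, instruments, trace distance -/

/-- Bit strings of length `k`. They also index the computational basis of a register of `k`
qubits, so that an operator on `k` qubits is a `Matrix (Bits k) (Bits k) ℂ`. -/
abbrev Bits (k : ℕ) : Type := Fin k → Bool

/-- A density operator. -/
def IsDensity {I : Type} [Fintype I] (ρ : Matrix I I ℂ) : Prop :=
  ρ.PosSemidef ∧ ρ.trace = 1

/-- The trace norm `tr |A| = tr √(Aᴴ A)`, i.e. the sum of the square roots of the eigenvalues
of `Aᴴ A`. -/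
def traceNorm {I : Type} [Fintype I] [DecidableEq I] (A : Matrix I I ℂ) : ℝ :=
  ∑ i, Real.sqrt ((Matrix.isHermitian_conjTranspose_mul_self A).eigenvalues i)

/-- The trace distance `δ(ρ, σ) = (1/2) tr |ρ - σ|`. -/
def traceDist {I : Type} [Fintype I] [DecidableEq I] (ρ σ : Matrix I I ℂ) : ℝ :=
  1 / 2 * traceNorm (ρ - σ)

/-- Probability of an outcome, as a complex scalar. -/
def prob {A : Type} (p : PMF A) (a : A) : ℂ := ((p a).toReal : ℂ)

/-- An arbitrary physical operation on a party's memory that has a classical part and a quantum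
part: for every classical input `k : K` a quantum instrument with classical outcome `l : L`
which maps operators on `ℂ^I` to operators on `ℂ^J`, given by Kraus operators. -/
structure Instrument (K I L J : Type) [Fintype I] [DecidableEq I] [Fintype L] [Fintype J] where
  /-- index set of the Kraus operators -/
  ι : Type
  [fintypeι : Fintype ι]
  /-- Kraus operators -/
  op : K → L → ι → Matrix J I ℂ
  /-- trace preservation -/
  complete : ∀ k, ∑ l, ∑ i, (op k l i)ᴴ * op k l i = 1

attribute [instance] Instrument.fintypeι

section InstrumentAction

variable {K I L J : Type} [Fintype I] [DecidableEq I] [Fintype L] [Fintype J]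

/-- The unnormalised post-measurement state for classical input `k` and classical outcome `l`. -/
def Instrument.branch (E : Instrument K I L J) (k : K) (l : L) (ρ : Matrix I I ℂ) :
    Matrix J J ℂ :=
  ∑ i, E.op k l i * ρ * (E.op k l i)ᴴ

/-- The action on a classical-quantum state `∑ k, |k⟩⟨k| ⊗ σ k`. -/
def Instrument.apply [Fintype K] (E : Instrument K I L J) (σ : K → Matrix I I ℂ) :
    L → Matrix J J ℂ :=
  fun l => ∑ k, E.branch k l (σ k)

end InstrumentAction

/-! ### BB84 encoding -/

/-- `⟨y|x⟩_θ` for one qubit. The bit `θ = false` stands for the computational basis `+`, and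
`θ = true` for the diagonal basis `×`. -/
def bb84Amp (θ x y : Bool) : ℂ :=
  if θ then (if x && y then -1 else 1) / (Real.sqrt 2 : ℂ) else (if x = y then 1 else 0)

/-- The vector `|x⟩_θ = |x₁⟩_{θ₁} ⊗ ⋯ ⊗ |x_n⟩_{θ_n}`. -/
def bb84Ket {n : ℕ} (x θ : Bits n) : Bits n → ℂ :=
  fun y => ∏ i, bb84Amp (θ i) (x i) (y i)

/-- The projector `|x⟩⟨x|_θ`. -/
def bb84State {n : ℕ} (x θ : Bits n) : Matrix (Bits n) (Bits n) ℂ :=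
  Matrix.vecMulVec (bb84Ket x θ) (star (bb84Ket x θ))

/-! ### Protocols -/

/-- A BB84-type two-party protocol with `n` qubits, for classical inputs in `U` and classical
outputs in `X` of Alice.

*Common reference string.* `crs` is the distribution of a public classical string, drawn before
the interaction (take `Ω = Unit` for a protocol in the plain model).

*Preparation.* Alice chooses uniform `x, θ` and sends `|x⟩_θ`; honest Bob measures it in
uniformly random bases `θ̂` and obtains `x̂`.

*Post-processing.* Arbitrary classical communication and classical local computation, in rounds;
in each round Bob sends a message (or aborts) and then Alice sends a message (or aborts).
Messages may be trivial, so that Alice may in effect speak first. There is at least one round: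
Bob can always abort after the preparation. A party that aborts ends the protocol; Alice's
output is then the symbol `⊥`.

`storagePoint` designates the point of the protocol from which a bound on Bob's quantum storage
is in force: right before the round with this number (rounds are counted from `0`, so that
`storagePoint = 0` is the end of the preparation phase). -/
structure Protocol (U X : Type) (n : ℕ) where
  /-- common reference strings -/
  Ω : Type
  [fintypeΩ : Fintype Ω]
  crs : PMF Ω
  /-- Alice's and Bob's messages -/
  MA : Type
  [fintypeMA : Fintype MA]
  MB : Type
  [fintypeMB : Fintype MB]
  /-- number of rounds of the post-processing -/
  rounds : ℕ
  rounds_pos : 0 < rounds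
  storagePoint : ℕ
  storagePoint_le : storagePoint ≤ rounds
  /-- Alice's local states in the post-processing -/
  SA : Type
  [fintypeSA : Fintype SA]
  /-- Alice's state at the start of the post-processing, from the reference string, her input,
  `x` and `θ` -/
  initA : Ω → U → Bits n → Bits n → PMF SA
  /-- Alice's reaction to a message of Bob; `none` means that she aborts -/
  stepA : SA → MB → PMF (Option (SA × MA))
  /-- Alice's output at the end of the last round; `none` is the symbol `⊥` -/
  outA : SA → PMF (Option X)
  /-- honest Bob's inputs, outputs and local states -/
  InB : Type
  OutB : Type
  SB : Type
  /-- Bob's state at the start of the post-processing, from the reference string, his input,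
  `x̂` and `θ̂` -/
  initB : Ω → InB → Bits n → Bits n → PMF SB
  /-- Bob's next message -/
  sendB : SB → PMF (Option (SB × MB))
  /-- Bob's reaction to a message of Alice -/
  recvB : SB → MA → PMF (Option SB)
  /-- Bob's output; `none` is the symbol `⊥` -/
  outB : SB → PMF (Option OutB)

attribute [instance] Protocol.fintypeΩ Protocol.fintypeMA Protocol.fintypeMB Protocol.fintypeSA

/-- Alice's behaviour in one round, with aborts: her state `none` means that the protocol has
been aborted, Bob's message `none` means that he aborts, and her message `none` tells Bob that
the protocol is aborted. -/
def Protocol.kernelA {U X : Type} {n : ℕ} (P : Protocol U X n) :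
    Option P.SA → Option P.MB → PMF (Option P.SA × Option P.MA)
  | some s, some b => (P.stepA s b).map fun r => (r.map Prod.fst, r.map Prod.snd)
  | _, _ => PMF.pure (none, none)

/-- Alice's final output; `none` is the symbol `⊥` of an aborted protocol. -/
def Protocol.outputA {U X : Type} {n : ℕ} (P : Protocol U X n) :
    Option P.SA → PMF (Option X)
  | some s => P.outA s
  | none => PMF.pure none

/-! ### Dishonest Bob -/

/-- A dishonest Bob attacking `P`: arbitrary quantum operations. He gets a classical input from
`Z` and `v` qubits `V'`, and finally outputs `y` qubits `Y'`. Before round `j` he holds a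
classical memory `C j` and `q j` qubits; between his message in round `j` and Alice's answer he
holds a classical memory `C' j` and `q' j` qubits. -/
structure Adversary {U X : Type} {n : ℕ} (P : Protocol U X n) where
  /-- classical and quantum input, quantum output -/
  Z : Type
  [fintypeZ : Fintype Z]
  [decEqZ : DecidableEq Z]
  v : ℕ
  y : ℕ
  /-- classical memory -/
  C : ℕ → Type
  [fintypeC : ∀ j, Fintype (C j)]
  C' : ℕ → Type
  [fintypeC' : ∀ j, Fintype (C' j)]
  /-- numbers of stored qubits -/
  q : ℕ → ℕ
  q' : ℕ → ℕ
  /-- operation on his input, the reference string and Alice's `n` qubits -/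
  prep : Instrument (Z × P.Ω) (Bits v × Bits n) (C 0) (Bits (q 0))
  /-- production of his message in round `j` -/
  send : ∀ j, Instrument (C j) (Bits (q j)) (C' j × Option P.MB) (Bits (q' j))
  /-- processing of Alice's message in round `j` -/
  recv : ∀ j, Instrument (C' j × Option P.MA) (Bits (q' j)) (C (j + 1)) (Bits (q (j + 1)))
  /-- production of his output -/
  final : Instrument (C P.rounds) (Bits (q P.rounds)) Unit (Bits y)

attribute [instance] Adversary.fintypeZ Adversary.decEqZ Adversary.fintypeC Adversary.fintypeC'

/-- `B` is a `γ`-BQSM Bob: from the designated point of the protocol on he stores at most `γ n`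
qubits, where `n` is the number of qubits sent initially. Neither his classical storage nor his
computing power is bounded. -/
def Adversary.IsBQSM {U X : Type} {n : ℕ} {P : Protocol U X n} (B : Adversary P) (γ : ℝ) :
    Prop :=
  (∀ j, P.storagePoint ≤ j → j ≤ P.rounds → (B.q j : ℝ) ≤ γ * n) ∧
  (∀ j, P.storagePoint ≤ j → j < P.rounds → (B.q' j : ℝ) ≤ γ * n)

section Execution

variable {U X : Type} {n : ℕ} {P : Protocol U X n}

/-- Joint state of Alice (classical) and Bob at the end of the preparation phase, for input `u`
of Alice, classical input `z` and quantum input `ρ` of Bob. -/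
def Adversary.prepState (B : Adversary P) (u : U) (z : B.Z)
    (ρ : Matrix (Bits B.v) (Bits B.v) ℂ) :
    Option P.SA → B.C 0 → Matrix (Bits (B.q 0)) (Bits (B.q 0)) ℂ :=
  fun s c => ∑ ω, ∑ x : Bits n, ∑ θ : Bits n,
    (prob P.crs ω * (1 / 2) ^ n * (1 / 2) ^ n * prob ((P.initA ω u x θ).map some) s) •
      B.prep.branch (z, ω) c (Matrix.kroneckerMap (· * ·) ρ (bb84State x θ))

/-- Effect of round `j` on the joint state: Bob sends, Alice reacts, Bob processes. -/
def Adversary.roundMap (B : Adversary P) (j : ℕ)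
    (σ : Option P.SA → B.C j → Matrix (Bits (B.q j)) (Bits (B.q j)) ℂ) :
    Option P.SA → B.C (j + 1) → Matrix (Bits (B.q (j + 1))) (Bits (B.q (j + 1))) ℂ :=
  fun s' => (B.recv j).apply fun ca : B.C' j × Option P.MA =>
    ∑ s, ∑ b, prob (P.kernelA s b) (s', ca.2) • (B.send j).apply (σ s) (ca.1, b)

/-- Joint state before round `j`. -/
def Adversary.stateAt (B : Adversary P) (u : U) (z : B.Z)
    (ρ : Matrix (Bits B.v) (Bits B.v) ℂ) :
    (j : ℕ) → Option P.SA → B.C j → Matrix (Bits (B.q j)) (Bits (B.q j)) ℂ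
  | 0 => B.prepState u z ρ
  | j + 1 => B.roundMap j (B.stateAt u z ρ j)

/-- Joint output of Alice (classical) and Bob, for given inputs. -/
def Adversary.realOut (B : Adversary P) (u : U) (z : B.Z)
    (ρ : Matrix (Bits B.v) (Bits B.v) ℂ) : Option X → Matrix (Bits B.y) (Bits B.y) ℂ :=
  fun x => ∑ s, prob (P.outputA s) x • B.final.apply (B.stateAt u z ρ P.rounds s) ()

end Execution

/-! ### The ideal world -/

/-- A classical non-reactive two-party functionality, as seen by honest Alice and dishonest Bob:
Alice's inputs `U` and outputs `X` (or `⊥`), Bob's inputs `V` and replies `Y`, and the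
conditional distribution of the outputs given the inputs. What a dishonest Bob may input
(for instance a request to abort) and learns may differ from what an honest Bob does. -/
structure Functionality where
  U : Type
  [fintypeU : Fintype U]
  [decEqU : DecidableEq U]
  X : Type
  [fintypeX : Fintype X]
  [decEqX : DecidableEq X]
  V : Type
  [fintypeV : Fintype V]
  Y : Type
  [fintypeY : Fintype Y]
  law : U → V → PMF (Option X × Y)

attribute [instance] Functionality.fintypeU Functionality.decEqU Functionality.fintypeX
  Functionality.decEqX Functionality.fintypeV Functionality.fintypeY

/-- An ideal-world dishonest Bob with classical input in `Z`, `v` input qubits and `y` output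
qubits: he produces an input for the functionality from his input, keeps a classical memory `C`
and `k` qubits, and computes his output from these and the reply of the functionality. -/
structure IdealAdversary (F : Functionality) (Z : Type) (v y : ℕ) where
  C : Type
  [fintypeC : Fintype C]
  k : ℕ
  ask : Instrument Z (Bits v) (C × F.V) (Bits k)
  final : Instrument (C × F.V × F.Y) (Bits k) Unit (Bits y)

attribute [instance] IdealAdversary.fintypeC

/-- Joint output of Alice (classical) and Bob in the ideal world, for given inputs. -/
def IdealAdversary.idealOut {F : Functionality} {Z : Type} {v y : ℕ}
    (B : IdealAdversary F Z v y) (u : F.U) (z : Z) (ρ : Matrix (Bits v) (Bits v) ℂ) :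
    Option F.X → Matrix (Bits y) (Bits y) ℂ :=
  fun x => B.final.apply (fun c : B.C × F.V × F.Y =>
    prob (F.law u c.2.1) (x, c.2.2) • B.ask.branch z (c.1, c.2.1) ρ) ()

/-! ### Security -/

/-- An input state `∑ P(u,z) |u⟩⟨u| ⊗ |z⟩⟨z| ⊗ ρ^z`: Alice's input `U` and Bob's quantum input
of `v` qubits are correlated only via Bob's classical input `Z`. -/
structure InputState (U Z : Type) (v : ℕ) where
  dist : PMF (U × Z)
  state : Z → Matrix (Bits v) (Bits v) ℂ
  isDensity : ∀ z, IsDensity (state z)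

/-- The output state `ρ_{U X Z Y'}` (classical in `U`, `X`, `Z`) when, given the input values
`u, z` and the quantum input `ρ`, Alice's output `x` and Bob's output register are in the joint
state `out u z ρ x`. -/
def outputState {U X Z : Type} [DecidableEq U] [DecidableEq X] [DecidableEq Z] {v y : ℕ}
    (inp : InputState U Z v)
    (out : U → Z → Matrix (Bits v) (Bits v) ℂ → Option X → Matrix (Bits y) (Bits y) ℂ) :
    Matrix (Bits y × (U × Option X × Z)) (Bits y × (U × Option X × Z)) ℂ :=
  Matrix.blockDiagonal fun w : U × Option X × Z =>
    prob inp.dist (w.1, w.2.2) • out w.1 w.2.2 (inp.state w.2.2) w.2.1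

/-- `f` vanishes faster than the inverse of any polynomial. -/
def Negligible (f : ℕ → ℝ) : Prop :=
  ∀ c : ℕ, ∃ N : ℕ, ∀ n : ℕ, N < n → f n ≤ ((n : ℝ) ^ c)⁻¹

/-- The protocol `Π` (a family indexed by the security parameter, with `N n` qubits for
parameter `n`) implements `F` unconditionally securely against `γ`-BQSM Bob: for every real-world
`γ`-BQSM adversary there is an ideal-world adversary such that for all input states the outputs
of the real and the ideal world are statistically indistinguishable. -/
def SecureAgainstBQSM (F : ℕ → Functionality) {N : ℕ → ℕ}
    (P : ∀ n, Protocol (F n).U (F n).X (N n)) (γ : ℝ) : Prop :=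
  ∀ B : ∀ n, Adversary (P n), (∀ n, (B n).IsBQSM γ) →
    ∃ B' : ∀ n, IdealAdversary (F n) (B n).Z (B n).v (B n).y,
      ∀ inp : ∀ n, InputState (F n).U (B n).Z (B n).v,
        Negligible fun n =>
          traceDist (outputState (inp n) (B n).realOut) (outputState (inp n) (B' n).idealOut)

/-! ### The compiler -/

/-- A keyed non-interactive commitment scheme for messages in `{0,1}²`, with the distribution of
the public key that is used in real executions. A commitment is opened by revealing the message
and the randomness. -/
structure Commitment where
  Key : Type
  [fintypeKey : Fintype Key]
  keyGen : PMF Key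
  Rand : Type
  [fintypeRand : Fintype Rand]
  [nonemptyRand : Nonempty Rand]
  Com : Type
  [fintypeCom : Fintype Com]
  commit : Key → Bool × Bool → Rand → Com

attribute [instance] Commitment.fintypeKey Commitment.fintypeRand Commitment.nonemptyRand
  Commitment.fintypeCom

/-- Test subsets of `m` positions that leave exactly `n` positions untested. -/
abbrev TestSet (m n : ℕ) : Type := {T : Finset (Fin m) // Tᶜ.card = n}

theorem TestSet.nonempty {m n : ℕ} (h : n ≤ m) : Nonempty (TestSet m n) := by
  obtain ⟨S, -, hS⟩ := Finset.exists_subset_card_eq (s := (Finset.univ : Finset (Fin m)))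
    (n := n) (by simpa using h)
  exact ⟨⟨Sᶜ, by rw [compl_compl]; exact hS⟩⟩

/-- Restriction of a string to the untested positions. -/
def TestSet.restrict {m n : ℕ} (T : TestSet m n) (x : Bits m) : Bits n :=
  fun i => x (T.1ᶜ.orderEmbOfFin T.2 i)

/-- Openings, position by position: basis and outcome `(θ̂ᵢ, x̂ᵢ)` and randomness `rᵢ`;
`none` at positions that are not opened. -/
abbrev Openings (K : Commitment) (m : ℕ) : Type := Fin m → Option ((Bool × Bool) × K.Rand)

/-- Alice's test: all commitments in the test set are correctly opened, and `x` and `x̂`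
coincide there wherever the bases do. -/
def accepts (K : Commitment) {m : ℕ} (pk : K.Key) (x θ : Bits m) (com : Fin m → K.Com)
    (T : Finset (Fin m)) (o : Openings K m) : Prop :=
  ∀ i ∈ T, ∃ (θ' x' : Bool) (r : K.Rand),
    o i = some ((θ', x'), r) ∧ com i = K.commit pk (θ', x') r ∧ (θ i = θ' → x i = x')

section Compiler

variable {U X : Type} {n : ℕ}

/-- Alice's local states in the compiled protocol: waiting for the commitments; waiting for the
openings; in the post-processing. -/
abbrev CompiledSA (P : Protocol U X n) (K : Commitment) (m : ℕ) : Type :=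
  ((P.Ω × K.Key) × U × Bits m × Bits m) ⊕
    (((P.Ω × K.Key) × U × Bits m × Bits m) × (Fin m → K.Com) × TestSet m n) ⊕ P.SA

/-- Alice's messages: test set; acceptance; messages of the post-processing. -/
abbrev CompiledMA (P : Protocol U X n) (m : ℕ) : Type := TestSet m n ⊕ Unit ⊕ P.MA

/-- Bob's messages: commitments; openings; messages of the post-processing. -/
abbrev CompiledMB (P : Protocol U X n) (K : Commitment) (m : ℕ) : Type :=
  (Fin m → K.Com) ⊕ Openings K m ⊕ P.MB

/-- Honest Bob's local states: before committing; with commitment randomness and possibly a test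
set; in the post-processing. -/
abbrev CompiledSB (P : Protocol U X n) (K : Commitment) (m : ℕ) : Type :=
  ((P.Ω × K.Key) × P.InB × Bits m × Bits m) ⊕
    (((P.Ω × K.Key) × P.InB × Bits m × Bits m) × (Fin m → K.Rand) × Option (TestSet m n)) ⊕ P.SB

open Classical in
/-- Honest Alice in the compiled protocol. On malformed messages she aborts. -/
def compiledStepA (P : Protocol U X n) (K : Commitment) {m : ℕ} (h : n ≤ m) :
    CompiledSA P K m → CompiledMB P K m → PMF (Option (CompiledSA P K m × CompiledMA P m))
  | .inl w, .inl com =>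
      haveI := TestSet.nonempty h
      (PMF.uniformOfFintype (TestSet m n)).map fun T =>
        some (.inr (.inl (w, com, T)), .inl T)
  | .inr (.inl (((ω, pk), u, x, θ), com, T)), .inr (.inl o) =>
      if accepts K pk x θ com T.1 o then
        (P.initA ω u (T.restrict x) (T.restrict θ)).map fun s =>
          some (.inr (.inr s), .inr (.inl ()))
      else PMF.pure none
  | .inr (.inr s), .inr (.inr b) =>
      (P.stepA s b).map fun r => r.map fun p => (.inr (.inr p.1), .inr (.inr p.2))
  | _, _ => PMF.pure none

/-- Alice's output in the compiled protocol. The last case does not occur after the last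
round. -/
def compiledOutA (P : Protocol U X n) (K : Commitment) (m : ℕ) :
    CompiledSA P K m → PMF (Option X)
  | .inr (.inr s) => P.outA s
  | _ => PMF.pure none

/-- Honest Bob's messages in the compiled protocol: position-wise commitments to `(θ̂, x̂)` with
uniform randomness; openings of the tested positions; messages of the post-processing. -/
def compiledSendB (P : Protocol U X n) (K : Commitment) (m : ℕ) :
    CompiledSB P K m → PMF (Option (CompiledSB P K m × CompiledMB P K m))
  | .inl ((ω, pk), v, x', θ') =>
      (PMF.uniformOfFintype (Fin m → K.Rand)).map fun r =>
        some (.inr (.inl (((ω, pk), v, x', θ'), r, none)),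
          .inl fun i => K.commit pk (θ' i, x' i) (r i))
  | .inr (.inl ((c, v, x', θ'), r, some T)) =>
      PMF.pure (some (.inr (.inl ((c, v, x', θ'), r, some T)),
        .inr (.inl fun i => if i ∈ T.1 then some ((θ' i, x' i), r i) else none)))
  | .inr (.inl (_, _, none)) => PMF.pure none
  | .inr (.inr s) =>
      (P.sendB s).map fun r => r.map fun p => (.inr (.inr p.1), .inr (.inr p.2))

/-- Honest Bob's reaction to Alice's messages in the compiled protocol. On malformed messages he
aborts. -/
def compiledRecvB (P : Protocol U X n) (K : Commitment) (m : ℕ) :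
    CompiledSB P K m → CompiledMA P m → PMF (Option (CompiledSB P K m))
  | .inr (.inl (w, r, none)), .inl T => PMF.pure (some (.inr (.inl (w, r, some T))))
  | .inr (.inl (((ω, _), v, x', θ'), _, some T)), .inr (.inl ()) =>
      (P.initB ω v (T.restrict x') (T.restrict θ')).map fun s => some (.inr (.inr s))
  | .inr (.inr s), .inr (.inr a) =>
      (P.recvB s a).map fun r => r.map fun s' => .inr (.inr s')
  | _, _ => PMF.pure none

/-- Honest Bob's output in the compiled protocol; `none` stands for an aborted protocol. The last
case does not occur after the last round. -/
def compiledOutB (P : Protocol U X n) (K : Commitment) (m : ℕ) :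
    CompiledSB P K m → PMF (Option P.OutB)
  | .inr (.inr s) => P.outB s
  | _ => PMF.pure none

/-- The compiled protocol with `m` qubits: the commitment key is part of the common reference
string; in the preparation phase `m` BB84 qubits are sent. The verification takes two rounds:
(1) Bob commits position-wise to `θ̂` and `x̂`, Alice sends a uniformly random test set `T` of
`m - n` positions; (2) Bob opens the commitments in `T`, Alice accepts or aborts. Then the
post-processing of `P` is conducted on the `n` untested positions. The storage bound sets in at
the same point of the post-processing as in `P`. -/
def Protocol.compile [Fintype U] (P : Protocol U X n) (K : Commitment) (m : ℕ) (h : n ≤ m) :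
    Protocol U X m where
  Ω := P.Ω × K.Key
  crs := P.crs.bind fun ω => K.keyGen.map fun pk => (ω, pk)
  MA := CompiledMA P m
  MB := CompiledMB P K m
  rounds := P.rounds + 2
  rounds_pos := Nat.succ_pos _
  storagePoint := P.storagePoint + 2
  storagePoint_le := Nat.add_le_add_right P.storagePoint_le 2
  SA := CompiledSA P K m
  initA := fun c u x θ => PMF.pure (.inl (c, u, x, θ))
  stepA := compiledStepA P K h
  outA := compiledOutA P K m
  InB := P.InB
  OutB := P.OutB
  SB := CompiledSB P K m
  initB := fun c v x' θ' => PMF.pure (.inl (c, v, x', θ'))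
  sendB := compiledSendB P K m
  recvB := compiledRecvB P K m
  outB := compiledOutB P K m

end Compiler

/-- The number `m = n / (1 - α)` of qubits of the compiled protocol, rounded down. -/
def compiledQubits (α : ℝ) (n : ℕ) : ℕ := ⌊(n : ℝ) / (1 - α)⌋₊

theorem le_compiledQubits {α : ℝ} (h0 : 0 < α) (h1 : α < 1) (n : ℕ) :
    n ≤ compiledQubits α n := by
  apply Nat.le_floor
  rw [le_div_iff₀ (by linarith)]
  nlinarith [Nat.cast_nonneg (α := ℝ) n]

/-- The compiled family `C^α(Π)`: for every value of the security parameter, `Π` with `N n`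
qubits is compiled to a protocol with `m = N n / (1 - α)` qubits, of which `m - N n`, i.e. a
fraction `α`, are tested. -/
def compiled {F : ℕ → Functionality} {N : ℕ → ℕ} (P : ∀ n, Protocol (F n).U (F n).X (N n))
    (K : ℕ → Commitment) (α : ℝ) (h0 : 0 < α) (h1 : α < 1) (n : ℕ) :
    Protocol (F n).U (F n).X (compiledQubits α (N n)) :=
  (P n).compile (K n) (compiledQubits α (N n)) (le_compiledQubits h0 h1 (N n))

end BQSM

end

/-! The proof is a perfect simulation. A Bob `B` against the compiled protocol is turned into a Bob
`B.reduce` against `P` with exactly the same joint output. The ideal-world adversary that exists for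
`B.reduce` then serves for `B`, with the same error.

`B.reduce` receives `n` BB84 qubits, draws a key, a test set `T` and uniform strings, and inserts
qubits that encode these strings at the positions of `T` (`TestSet.insert`). He then runs the
verification phase with `B`, answering in Alice's place. This is possible because the verdict
depends on `x` and `θ` only inside `T`, where he chose them himself (`Adversary.verifyPull_merge`).
The merged `m`-bit strings are uniform and independent of `T`, just as in a run with honest Alice
(`expect_coinLaw`, which rests on `TestSet.expect_merge`). Commitments are merely passed through, so
neither hiding nor binding plays a role.

All this belongs to the preparation of `B.reduce`, before any storage bound is in force. From then
on he holds as many qubits as `B` holds two rounds later, and `γ (1 - α) m ≤ γ n`. A failed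
verification is remembered in a classical flag and makes him abort in the first round, so that Alice
outputs `⊥` in both worlds; this is where `rounds_pos` is needed.

Executions are compared backwards. Joint states are paired with arbitrary families `G` of linear
maps; `Instrument.pull` and `expect` then express operations and random draws as nested
continuations, which linearity allows to be reordered. `Adversary.sum_stateAt` is the invariant
carried through the rounds, and `Adversary.realOut_reduce` is the resulting equality of outputs. -/

noncomputable section

namespace BQSM

/-! ### Expectations -/

section Expect

variable {A B N : Type} [Fintype A] [AddCommGroup N] [Module ℂ N]

/-- Expectation of a vector-valued function. -/
def expect (p : PMF A) (G : A → N) : N := ∑ a, prob p a • G a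

theorem sum_prob (p : PMF A) : ∑ a, prob p a = 1 := by
  have h : ∑ a, (p a).toReal = 1 := by
    rw [← ENNReal.toReal_sum fun a _ => p.apply_ne_top a, ← tsum_fintype (L := .unconditional _),
      p.tsum_coe, ENNReal.toReal_one]
  simp only [prob]
  exact_mod_cast h

theorem prob_bind (p : PMF A) (f : A → PMF B) (b : B) :
    prob (p.bind f) b = ∑ a, prob p a * prob (f a) b := by
  simp only [prob]
  rw [PMF.bind_apply, tsum_fintype,
    ENNReal.toReal_sum fun a _ => ENNReal.mul_ne_top (p.apply_ne_top a) ((f a).apply_ne_top b)]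
  simp only [ENNReal.toReal_mul]
  push_cast
  rfl

theorem expect_const (p : PMF A) (v : N) : expect p (fun _ => v) = v := by
  rw [expect, ← Finset.sum_smul, sum_prob, one_smul]

theorem expect_pure (a : A) (G : A → N) : expect (PMF.pure a) G = G a := by
  classical
  rw [expect, Finset.sum_eq_single a]
  · simp [prob]
  · intro b _ hb
    simp [prob, PMF.pure_apply, hb]
  · simp

theorem expect_bind [Fintype B] (p : PMF A) (f : A → PMF B) (G : B → N) :
    expect (p.bind f) G = expect p fun a => expect (f a) G := by
  simp only [expect, prob_bind, Finset.sum_smul, Finset.smul_sum, mul_smul]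
  exact Finset.sum_comm

theorem expect_map [Fintype B] (p : PMF A) (f : A → B) (G : B → N) :
    expect (p.map f) G = expect p fun a => G (f a) := by
  rw [← PMF.bind_pure_comp, expect_bind]
  simp only [Function.comp_apply, expect_pure]

theorem expect_comm [Fintype B] (p : PMF A) (q : PMF B) (G : A → B → N) :
    (expect p fun a => expect q fun b => G a b) = expect q fun b => expect p fun a => G a b := by
  simp only [expect, Finset.smul_sum]
  rw [Finset.sum_comm]
  exact Finset.sum_congr rfl fun b _ => Finset.sum_congr rfl fun a _ => smul_comm _ _ _

theorem expect_uniform [Nonempty A] (G : A → N) :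
    expect (PMF.uniformOfFintype A) G = ((Fintype.card A : ℂ)⁻¹) • ∑ a, G a := by
  simp only [expect, prob, PMF.uniformOfFintype_apply, Finset.smul_sum, ENNReal.toReal_inv,
    ENNReal.toReal_natCast, Complex.ofReal_inv, Complex.ofReal_natCast]

end Expect

/-! ### Composition of instruments -/

section Pull

variable {K K' I L L' J M H : Type} [Fintype I] [DecidableEq I] [Fintype L] [Fintype L']
  [Fintype J] [DecidableEq J] [Fintype M] [Fintype H]
  {N : Type} [AddCommGroup N] [Module ℂ N]

/-- `Instrument.branch` as a linear map. -/
def Instrument.branchMap {J : Type} [Fintype J] (E : Instrument K I L J) (k : K) (l : L) :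
    Matrix I I ℂ →ₗ[ℂ] Matrix J J ℂ where
  toFun := E.branch k l
  map_add' ρ σ := by
    simp [Instrument.branch, Matrix.mul_add, Matrix.add_mul, Finset.sum_add_distrib]
  map_smul' a ρ := by
    simp [Instrument.branch, Finset.smul_sum]

@[simp]
theorem Instrument.branchMap_apply {J : Type} [Fintype J] (E : Instrument K I L J) (k : K) (l : L)
    (ρ : Matrix I I ℂ) : E.branchMap k l ρ = E.branch k l ρ := rfl

/-- Running an instrument on classical input `k` and continuing with the linear map `G l` on
outcome `l`. -/
def Instrument.pull {J : Type} [Fintype J] (E : Instrument K I L J) (k : K)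
    (G : L → (Matrix J J ℂ →ₗ[ℂ] N)) : Matrix I I ℂ →ₗ[ℂ] N :=
  ∑ l, G l ∘ₗ E.branchMap k l

theorem Instrument.pull_apply {J : Type} [Fintype J] (E : Instrument K I L J) (k : K)
    (G : L → (Matrix J J ℂ →ₗ[ℂ] N)) (ρ : Matrix I I ℂ) :
    E.pull k G ρ = ∑ l, G l (E.branch k l ρ) := by
  simp [Instrument.pull]

/-- Linearity: a draw whose law does not depend on the outcome of `E` may be made before or after
`E`. This moves Alice's coins to the front of an execution or back to her turn. -/
theorem Instrument.pull_expect {J A : Type} [Fintype J] [Fintype A] (E : Instrument K I L J)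
    (k : K) (p : PMF A) (G : L → A → (Matrix J J ℂ →ₗ[ℂ] N)) :
    (E.pull k fun l => expect p fun a => G l a) = expect p fun a => E.pull k fun l => G l a := by
  ext1 ρ
  simp only [expect, LinearMap.sum_apply, LinearMap.smul_apply, pull_apply, Finset.smul_sum]
  exact Finset.sum_comm

open Classical in
/-- Classical pre- and postprocessing of an instrument, with memory of the classical input. -/
def Instrument.relabel {J : Type} [Fintype J] (E : Instrument K I L J) (g : K' → K)
    (f : K' → L → L') : Instrument K' I L' J where
  -- The old outcome stays in the Kraus index, so outcomes identified by `f` contribute a sum of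
  -- operations and not a sum of amplitudes.
  ι := E.ι × L
  op := fun k l' i => if f k i.2 = l' then E.op (g k) i.2 i.1 else 0
  complete := fun k => by
    rw [← E.complete (g k), Finset.sum_comm, Fintype.sum_prod_type, Finset.sum_comm]
    refine Finset.sum_congr rfl fun l _ => Finset.sum_congr rfl fun i _ => ?_
    rw [Finset.sum_eq_single (f k l)]
    · simp
    · intro l' _ h
      simp [h.symm]
    · simp

theorem Instrument.pull_relabel {J : Type} [Fintype J] (E : Instrument K I L J) (g : K' → K)
    (f : K' → L → L') (k : K') (G : L' → (Matrix J J ℂ →ₗ[ℂ] N)) :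
    (E.relabel g f).pull k G = E.pull (g k) fun l => G (f k l) := by
  classical
  ext1 ρ
  simp only [pull_apply, branch, map_sum]
  change ∑ l', ∑ i : E.ι × L, G l' ((if f k i.2 = l' then E.op (g k) i.2 i.1 else 0) * ρ *
    (if f k i.2 = l' then E.op (g k) i.2 i.1 else 0)ᴴ) = _
  rw [Finset.sum_comm, Fintype.sum_prod_type, Finset.sum_comm]
  refine Finset.sum_congr rfl fun l _ => Finset.sum_congr rfl fun i _ => ?_
  rw [Finset.sum_eq_single (f k l)]
  · simp
  · intro l' _ h
    simp [h.symm]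
  · simp

/-- Sequential composition; the second instrument gets the outcome of the first one. -/
def Instrument.comp (E : Instrument K I L J) (F : Instrument L J M H) : Instrument K I M H where
  ι := L × E.ι × F.ι
  op := fun k x i => F.op i.1 x i.2.2 * E.op k i.1 i.2.1
  complete := fun k => by
    rw [← E.complete k, Finset.sum_comm, Fintype.sum_prod_type]
    refine Finset.sum_congr rfl fun l _ => ?_
    rw [Fintype.sum_prod_type]
    refine Finset.sum_congr rfl fun i _ => ?_
    have h := congrArg (fun A => (E.op k l i)ᴴ * A * E.op k l i) (F.complete l)
    simp only [Matrix.mul_one] at h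
    rw [← h, Finset.sum_comm]
    simp only [Matrix.conjTranspose_mul, Matrix.mul_sum, Matrix.sum_mul, Matrix.mul_assoc]

/-- Composition becomes nesting of continuations, so a composite adversary unfolds into its
successive operations. -/
theorem Instrument.pull_comp (E : Instrument K I L J) (F : Instrument L J M H) (k : K)
    (G : M → (Matrix H H ℂ →ₗ[ℂ] N)) :
    (E.comp F).pull k G = E.pull k fun l => F.pull l G := by
  ext1 ρ
  simp only [pull_apply]
  rw [Finset.sum_comm]
  refine Finset.sum_congr rfl fun x _ => ?_
  rw [← map_sum]
  congr 1
  simp only [branch]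
  change ∑ i : L × E.ι × F.ι, F.op i.1 x i.2.2 * E.op k i.1 i.2.1 * ρ *
    (F.op i.1 x i.2.2 * E.op k i.1 i.2.1)ᴴ = _
  simp only [Fintype.sum_prod_type, Matrix.conjTranspose_mul, Matrix.mul_sum, Matrix.sum_mul,
    Matrix.mul_assoc]
  refine Finset.sum_congr rfl fun l _ => Finset.sum_comm

/-- Drawing a classical value, without touching the quantum register. -/
def Instrument.sample (I : Type) [Fintype I] [DecidableEq I] (p : K → PMF L) :
    Instrument K I L I where
  ι := Unit
  op := fun k l _ => (Real.sqrt (p k l).toReal : ℂ) • 1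
  complete := fun k => by
    have h : ∑ l, prob (p k) l • (1 : Matrix I I ℂ) = 1 := by
      rw [← Finset.sum_smul, sum_prob, one_smul]
    refine Eq.trans ?_ h
    refine Finset.sum_congr rfl fun l _ => ?_
    simp only [Finset.univ_unique, Finset.sum_singleton, Matrix.conjTranspose_smul,
      Matrix.conjTranspose_one, Matrix.smul_mul, Matrix.one_mul, smul_smul]
    congr 1
    simp only [prob, Complex.star_def, Complex.conj_ofReal]
    rw [← Complex.ofReal_mul, Real.mul_self_sqrt ENNReal.toReal_nonneg]

theorem Instrument.pull_sample (p : K → PMF L) (k : K) (G : L → (Matrix I I ℂ →ₗ[ℂ] N)) :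
    (Instrument.sample I p).pull k G = expect (p k) G := by
  ext1 ρ
  simp only [pull_apply, expect, LinearMap.sum_apply, LinearMap.smul_apply]
  refine Finset.sum_congr rfl fun l _ => ?_
  rw [← map_smul]
  congr 1
  change ∑ i : Unit, ((Real.sqrt (p k l).toReal : ℂ) • (1 : Matrix I I ℂ)) * ρ *
    ((Real.sqrt (p k l).toReal : ℂ) • (1 : Matrix I I ℂ))ᴴ = _
  simp only [Finset.univ_unique, Finset.sum_singleton, Matrix.conjTranspose_smul,
    Matrix.conjTranspose_one, Matrix.smul_mul, Matrix.mul_smul, Matrix.one_mul, Matrix.mul_one,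
    smul_smul]
  congr 1
  simp only [prob, Complex.star_def, Complex.conj_ofReal]
  rw [← Complex.ofReal_mul, Real.mul_self_sqrt ENNReal.toReal_nonneg]

/-- An isometry depending on the classical input. -/
def Instrument.ofIsometry {J : Type} [Fintype J] (V : K → Matrix J I ℂ)
    (hV : ∀ k, (V k)ᴴ * V k = 1) : Instrument K I Unit J where
  ι := Unit
  op := fun k _ _ => V k
  complete := fun k => by simpa using hV k

theorem Instrument.pull_ofIsometry {J : Type} [Fintype J] (V : K → Matrix J I ℂ)
    (hV : ∀ k, (V k)ᴴ * V k = 1) (k : K) (G : Unit → (Matrix J J ℂ →ₗ[ℂ] N))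
    (ρ : Matrix I I ℂ) :
    (Instrument.ofIsometry V hV).pull k G ρ = G () (V k * ρ * (V k)ᴴ) := by
  rw [pull_apply, Fintype.sum_unique]
  congr 1
  exact Fintype.sum_unique (ι := Unit) _

end Pull

/-! ### Inserting qubits into a BB84 string -/

theorem sum_bb84Amp (θ x x' : Bool) :
    ∑ y, star (bb84Amp θ x y) * bb84Amp θ x' y = if x = x' then 1 else 0 := by
  have h : ((Real.sqrt 2 : ℝ) : ℂ) * (Real.sqrt 2 : ℝ) = 2 := by
    rw [← Complex.ofReal_mul, Real.mul_self_sqrt (by norm_num)]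
    norm_num
  have h' : ((Real.sqrt 2 : ℝ) : ℂ) ≠ 0 := by
    simp
  cases θ <;> cases x <;> cases x' <;> simp [bb84Amp] <;> field_simp <;> (try rw [sq, h]) <;>
    norm_num

/-- The inner product factorises over the qubits, which reduces orthonormality to `sum_bb84Amp`. -/
theorem sum_bb84Ket {n : ℕ} (θ x x' : Bits n) :
    ∑ y, star (bb84Ket x θ y) * bb84Ket x' θ y = if x = x' then 1 else 0 := by
  have h : ∀ y : Bits n, star (bb84Ket x θ y) * bb84Ket x' θ y =
      ∏ i, star (bb84Amp (θ i) (x i) (y i)) * bb84Amp (θ i) (x' i) (y i) := fun y => by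
    rw [Finset.prod_mul_distrib, bb84Ket, bb84Ket, star_prod]
  simp only [h]
  rw [← Fintype.prod_sum fun i b => star (bb84Amp (θ i) (x i) b) * bb84Amp (θ i) (x' i) b]
  simp only [sum_bb84Amp]
  rw [Finset.prod_ite_zero]
  simp [funext_iff]

section Merge

variable {m n : ℕ}

/-- The string that is `x` on the untested positions and `x'` on the test set. -/
def TestSet.merge (T : TestSet m n) (x : Bits n) (x' : Bits m) : Bits m :=
  fun i => if h : i ∈ T.1ᶜ then x ((T.1ᶜ.orderIsoOfFin T.2).symm ⟨i, h⟩) else x' i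

theorem TestSet.merge_of_mem (T : TestSet m n) (x : Bits n) (x' : Bits m) {i : Fin m}
    (h : i ∈ T.1) : T.merge x x' i = x' i := by
  simp [TestSet.merge, h]

theorem TestSet.merge_embed (T : TestSet m n) (x : Bits n) (x' : Bits m) (k : Fin n) :
    T.merge x x' (T.1ᶜ.orderEmbOfFin T.2 k) = x k := by
  have h : T.1ᶜ.orderEmbOfFin T.2 k ∈ T.1ᶜ := Finset.orderEmbOfFin_mem _ _ _
  rw [TestSet.merge, dif_pos h]
  congr 1
  rw [OrderIso.symm_apply_eq]
  rfl

theorem TestSet.exists_embed (T : TestSet m n) {i : Fin m} (h : i ∉ T.1) :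
    ∃ k, T.1ᶜ.orderEmbOfFin T.2 k = i := by
  have : i ∈ Set.range (T.1ᶜ.orderEmbOfFin T.2) := by simpa using h
  exact this

theorem TestSet.restrict_merge (T : TestSet m n) (x : Bits n) (x' : Bits m) :
    T.restrict (T.merge x x') = x :=
  funext fun k => T.merge_embed x x' k

/-- The overwritten bits are exactly those kept in `T.restrict x'`, so merging can be undone. This
makes `TestSet.swap` an involution. -/
theorem TestSet.merge_restrict_merge (T : TestSet m n) (x : Bits n) (x' : Bits m) :
    T.merge (T.restrict x') (T.merge x x') = x' := by
  funext i
  by_cases h : i ∈ T.1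
  · rw [T.merge_of_mem _ _ h, T.merge_of_mem _ _ h]
  · obtain ⟨k, rfl⟩ := T.exists_embed h
    rw [T.merge_embed]
    rfl

theorem TestSet.merge_injective (T : TestSet m n) (x' : Bits m) :
    Function.Injective fun x => T.merge x x' := fun a b h => by
  rw [← T.restrict_merge a x', ← T.restrict_merge b x']
  exact congrArg T.restrict h

/-- Exchanging the strings on the untested positions. -/
def TestSet.swap (T : TestSet m n) : Bits n × Bits m ≃ Bits n × Bits m :=
  Function.Involutive.toPerm (fun p => (T.restrict p.2, T.merge p.1 p.2)) fun p =>
    Prod.ext (T.restrict_merge p.1 p.2) (T.merge_restrict_merge p.1 p.2)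

/-- Reindexing by `T.swap` turns the merged string into a free variable; the other component no
longer occurs and is counted by the factor `2 ^ n`. -/
theorem TestSet.sum_merge {N : Type} [AddCommGroup N] [Module ℂ N] (T : TestSet m n)
    (G : Bits n → Bits m → N) :
    ∑ x, ∑ x', G x (T.merge x x') = (2 : ℂ) ^ n • ∑ y, G (T.restrict y) y := by
  rw [← Fintype.sum_prod_type', ← T.swap.sum_comp]
  change ∑ p : Bits n × Bits m, G (T.restrict p.2) (T.merge (T.restrict p.2) (T.merge p.1 p.2)) = _
  simp only [T.merge_restrict_merge]
  rw [Fintype.sum_prod_type]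
  simp only [Finset.sum_const, Finset.card_univ, Fintype.card_fun, Fintype.card_bool,
    Fintype.card_fin]
  rw [← Nat.cast_smul_eq_nsmul ℂ]
  push_cast
  rfl

theorem TestSet.prod_eq (T : TestSet m n) (f : Fin m → ℂ) :
    ∏ i, f i = (∏ k, f (T.1ᶜ.orderEmbOfFin T.2 k)) * ∏ i ∈ T.1, f i := by
  rw [← Finset.prod_compl_mul_prod T.1 f]
  congr 1
  conv_lhs => rw [← Finset.image_orderEmbOfFin_univ T.1ᶜ T.2]
  exact Finset.prod_image fun a _ b _ h => (T.1ᶜ.orderEmbOfFin T.2).injective h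

/-- The isometry that inserts the qubits `|x'⟩_θ'` at the positions of the test set. -/
def TestSet.insert (T : TestSet m n) (x' θ' : Bits m) : Matrix (Bits m) (Bits n) ℂ :=
  fun y b => bb84Ket (T.merge b x') (T.merge (fun _ => false) θ') y

/-- The columns are BB84 kets in one common basis string, for distinct bit strings because `T.merge
· x'` is injective. -/
theorem TestSet.insert_isometry (T : TestSet m n) (x' θ' : Bits m) :
    (T.insert x' θ')ᴴ * T.insert x' θ' = 1 := by
  ext a b
  rw [Matrix.mul_apply, Matrix.one_apply]
  simp only [Matrix.conjTranspose_apply, TestSet.insert]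
  rw [sum_bb84Ket]
  exact if_congr (T.merge_injective x').eq_iff rfl rfl

/-- Amplitudes factor into an untested and a tested part. On the untested positions `T.insert` uses
the computational basis, so it acts there as the identity and the sum collapses to `b = T.restrict
y`. Hence the insertion needs no knowledge of `x` or `θ`. -/
theorem TestSet.insert_mulVec (T : TestSet m n) (x' θ' : Bits m) (x θ : Bits n) :
    T.insert x' θ' *ᵥ bb84Ket x θ = bb84Ket (T.merge x x') (T.merge θ θ') := by
  funext y
  simp only [Matrix.mulVec, dotProduct, TestSet.insert]
  have h : ∀ b θ₁, bb84Ket (T.merge b x') (T.merge θ₁ θ') y =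
      bb84Ket b θ₁ (T.restrict y) * ∏ i ∈ T.1, bb84Amp (θ' i) (x' i) (y i) := fun b θ₁ => by
    rw [bb84Ket, T.prod_eq]
    simp only [T.merge_embed]
    congr 1
    exact Finset.prod_congr rfl fun i hi => by rw [T.merge_of_mem _ _ hi, T.merge_of_mem _ _ hi]
  have h₀ : ∀ b z : Bits n, bb84Ket b (fun _ => false) z = if b = z then 1 else 0 := fun b z => by
    simp only [bb84Ket, bb84Amp]
    simp [Finset.prod_ite_zero, funext_iff]
  simp only [h, h₀]
  rw [Finset.sum_eq_single (T.restrict y)]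
  · simp [mul_comm]
  · intro b _ hb
    simp [hb]
  · simp

theorem TestSet.insert_bb84State (T : TestSet m n) (x' θ' : Bits m) (x θ : Bits n) :
    T.insert x' θ' * bb84State x θ * (T.insert x' θ')ᴴ =
      bb84State (T.merge x x') (T.merge θ θ') := by
  rw [bb84State, Matrix.mul_vecMulVec, Matrix.vecMulVec_mul, ← Matrix.star_mulVec,
    T.insert_mulVec]
  rfl

end Merge

/-! ### Executions, read backwards -/

theorem expect_congr {A N : Type} [Fintype A] [AddCommGroup N] [Module ℂ N] (p : PMF A)
    {G G' : A → N} (h : ∀ a, G a = G' a) : expect p G = expect p G' :=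
  congrArg _ (funext h)

theorem expect_apply {A M N : Type} [Fintype A] [AddCommGroup M] [Module ℂ M] [AddCommGroup N]
    [Module ℂ N] (p : PMF A) (G : A → (M →ₗ[ℂ] N)) (x : M) :
    expect p G x = expect p fun a => G a x := by
  simp [expect]

theorem expect_uniform_bits {k : ℕ} {N : Type} [AddCommGroup N] [Module ℂ N] (G : Bits k → N) :
    expect (PMF.uniformOfFintype (Bits k)) G = ((1 / 2 : ℂ) ^ k) • ∑ x, G x := by
  rw [expect_uniform]
  simp

/-- Overwriting the untested positions of a uniform string by a uniform string gives a uniform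
string. -/
theorem TestSet.expect_merge {m n : ℕ} {N : Type} [AddCommGroup N] [Module ℂ N] (T : TestSet m n)
    (G : Bits n → Bits m → N) :
    (expect (PMF.uniformOfFintype (Bits n)) fun x =>
      expect (PMF.uniformOfFintype (Bits m)) fun x' => G x (T.merge x x')) =
    expect (PMF.uniformOfFintype (Bits m)) fun y => G (T.restrict y) y := by
  simp only [expect_uniform_bits]
  -- The factor `2 ^ n` from `T.sum_merge` cancels the normalisation of the uniform `n`-bit string.
  rw [← Finset.smul_sum, T.sum_merge, smul_comm _ ((2 : ℂ) ^ n), smul_comm _ ((2 : ℂ) ^ n),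
    smul_smul, ← mul_pow]
  simp

section Backward

variable {U X : Type} {n : ℕ} {P : Protocol U X n} {N : Type} [AddCommGroup N] [Module ℂ N]

theorem Instrument.sum_pull_apply {K I L J : Type} [Fintype K] [Fintype I] [DecidableEq I]
    [Fintype L] [Fintype J] (E : Instrument K I L J) (G : L → (Matrix J J ℂ →ₗ[ℂ] N))
    (σ : K → Matrix I I ℂ) :
    ∑ l, G l (E.apply σ l) = ∑ k, E.pull k G (σ k) := by
  simp only [Instrument.apply, Instrument.pull_apply, map_sum]
  exact Finset.sum_comm

theorem Instrument.pull_congr {K I L J : Type} [Fintype I] [DecidableEq I]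
    [Fintype L] [Fintype J] (E : Instrument K I L J) (k : K)
    {G G' : L → (Matrix J J ℂ →ₗ[ℂ] N)} (h : ∀ l, G l = G' l) : E.pull k G = E.pull k G' :=
  congrArg _ (funext h)

/-- The continuation of a round: a linear functional of the joint state after round `j` as a
functional of the joint state before it. -/
def Adversary.roundPull (B : Adversary P) (j : ℕ)
    (G : Option P.SA → B.C (j + 1) →
      (Matrix (Bits (B.q (j + 1))) (Bits (B.q (j + 1))) ℂ →ₗ[ℂ] N)) :
    Option P.SA → B.C j → (Matrix (Bits (B.q j)) (Bits (B.q j)) ℂ →ₗ[ℂ] N) :=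
  fun s c => (B.send j).pull c fun d =>
    expect (P.kernelA s d.2) fun r => (B.recv j).pull (d.1, r.2) fun c' => G r.1 c'

omit [Module ℂ N] in
theorem sum_round_comm {S C A S' D : Type} [Fintype S] [Fintype C] [Fintype A] [Fintype S']
    [Fintype D] (f : S → C → A → S' → D → N) :
    ∑ s, ∑ c, ∑ a, ∑ s', ∑ d, f s c a s' d = ∑ s', ∑ c, ∑ d, ∑ s, ∑ a, f s c a s' d := by
  rw [Finset.sum_comm]
  conv_rhs => rw [Finset.sum_comm]
  refine Finset.sum_congr rfl fun c _ => ?_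
  calc ∑ s, ∑ a, ∑ s', ∑ d, f s c a s' d
      = ∑ p : S × A, ∑ r : S' × D, f p.1 c p.2 r.1 r.2 := by simp only [Fintype.sum_prod_type]
    _ = ∑ r : S' × D, ∑ p : S × A, f p.1 c p.2 r.1 r.2 := Finset.sum_comm
    _ = ∑ s', ∑ d, ∑ s, ∑ a, f s c a s' d := by simp only [Fintype.sum_prod_type]

omit [Module ℂ N] in
theorem sum_prep_comm {S C A S' D : Type} [Fintype S] [Fintype C] [Fintype A] [Fintype S']
    [Fintype D] (f : S → C → A → S' → D → N) :
    ∑ s, ∑ c, ∑ a, ∑ s', ∑ d, f s c a s' d = ∑ a, ∑ s', ∑ d, ∑ s, ∑ c, f s c a s' d := by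
  calc ∑ s, ∑ c, ∑ a, ∑ s', ∑ d, f s c a s' d
      = ∑ p : S × C, ∑ r : A × S' × D, f p.1 p.2 r.1 r.2.1 r.2.2 := by
        simp only [Fintype.sum_prod_type]
    _ = ∑ r : A × S' × D, ∑ p : S × C, f p.1 p.2 r.1 r.2.1 r.2.2 := Finset.sum_comm
    _ = ∑ a, ∑ s', ∑ d, ∑ s, ∑ c, f s c a s' d := by simp only [Fintype.sum_prod_type]

/-- `roundPull` is dual to `roundMap`. With it, rounds are analysed from Alice's and Bob's values at
the start of the round. -/
theorem Adversary.sum_roundMap (B : Adversary P) (j : ℕ)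
    (G : Option P.SA → B.C (j + 1) →
      (Matrix (Bits (B.q (j + 1))) (Bits (B.q (j + 1))) ℂ →ₗ[ℂ] N))
    (σ : Option P.SA → B.C j → Matrix (Bits (B.q j)) (Bits (B.q j)) ℂ) :
    ∑ s, ∑ c, G s c (B.roundMap j σ s c) = ∑ s, ∑ c, B.roundPull j G s c (σ s c) := by
  simp only [Adversary.roundMap, Adversary.roundPull, Instrument.sum_pull_apply]
  simp only [← Instrument.sum_pull_apply (N := N) (B.send j)]
  simp only [expect_apply]
  simp only [expect, Fintype.sum_prod_type, map_sum, map_smul]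
  exact sum_round_comm fun s c a s' b => prob (P.kernelA s' b) (s, a) •
    (B.recv j).pull (c, a) (G s) ((B.send j).apply (σ s') (c, b))

/-- The base of the backward reading: the weights `(1 / 2) ^ n` are uniform draws, and everything
random before Bob's first operation becomes an explicit expectation. -/
theorem Adversary.sum_prepState (B : Adversary P) (u : U) (z : B.Z)
    (ρ : Matrix (Bits B.v) (Bits B.v) ℂ)
    (G : Option P.SA → B.C 0 → (Matrix (Bits (B.q 0)) (Bits (B.q 0)) ℂ →ₗ[ℂ] N)) :
    ∑ s, ∑ c, G s c (B.prepState u z ρ s c) =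
      expect P.crs fun ω => expect (PMF.uniformOfFintype (Bits n)) fun x =>
        expect (PMF.uniformOfFintype (Bits n)) fun θ => expect (P.initA ω u x θ) fun s =>
          B.prep.pull (z, ω) (G (some s)) (Matrix.kroneckerMap (· * ·) ρ (bb84State x θ)) := by
  have h : ∀ ω x θ, (expect (P.initA ω u x θ) fun s =>
      B.prep.pull (z, ω) (G (some s)) (Matrix.kroneckerMap (· * ·) ρ (bb84State x θ))) =
      expect ((P.initA ω u x θ).map some) fun s =>
        B.prep.pull (z, ω) (G s) (Matrix.kroneckerMap (· * ·) ρ (bb84State x θ)) :=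
    fun ω x θ => (expect_map (P.initA ω u x θ) some fun s =>
      B.prep.pull (z, ω) (G s) (Matrix.kroneckerMap (· * ·) ρ (bb84State x θ))).symm
  simp only [h, expect_uniform_bits]
  simp only [expect, Instrument.pull_apply, Adversary.prepState, map_sum, map_smul,
    Finset.smul_sum, smul_smul]
  refine (sum_prep_comm _).trans ?_
  refine Finset.sum_congr rfl fun ω _ => Finset.sum_congr rfl fun x _ =>
    Finset.sum_congr rfl fun θ _ => Finset.sum_congr rfl fun s _ => Finset.sum_congr rfl fun c _ => ?_
  simp only [mul_assoc]

end Backward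

/-! ### The reduction -/

section Reduction

variable {U X : Type} [Fintype U] {n m : ℕ} {P : Protocol U X n} {K : Commitment} {h : n ≤ m}

/-- What Alice replies to the commitments. -/
def testReply (P : Protocol U X n) (K : Commitment) (T : TestSet m n) :
    Option (CompiledMB P K m) → Option (CompiledMA P m)
  | some (.inl _) => some (.inl T)
  | _ => none

open Classical in
/-- Whether Alice passes Bob's commitments and openings. -/
def verdict (P : Protocol U X n) (K : Commitment) (pk : K.Key) (T : TestSet m n) (x θ : Bits m) :
    Option (CompiledMB P K m) → Option (CompiledMB P K m) → Bool
  | some (.inl com), some (.inr (.inl o)) => decide (accepts K pk x θ com T.1 o)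
  | _, _ => false

/-- What Alice replies to the openings. -/
def verdictReply (P : Protocol U X n) (m : ℕ) : Bool → Option (CompiledMA P m)
  | true => some (.inr (.inl ()))
  | false => none

/-- A message of the compiled protocol as a message of the original one; the flag forces an
abort. -/
def stripMessage (P : Protocol U X n) (K : Commitment) (m : ℕ) :
    Bool → Option (CompiledMB P K m) → Option P.MB
  | false, some (.inr (.inr b)) => some b
  | _, _ => none

/-- A state of Alice in the original protocol as one in the compiled protocol. The flag says that
the verification has failed. -/
def liftState (P : Protocol U X n) (K : Commitment) (m : ℕ) :
    Option P.SA → Bool → Option (CompiledSA P K m)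
  | some s, false => some (.inr (.inr s))
  | _, _ => none

omit [Fintype U] in
-- Alice's test inspects positions in `T` only.
theorem verdict_congr (pk : K.Key) (T : TestSet m n) {x x' θ θ' : Bits m}
    (hx : ∀ ⦃i⦄, i ∈ T.1 → x i = x' i) (hθ : ∀ ⦃i⦄, i ∈ T.1 → θ i = θ' i)
    (b b' : Option (CompiledMB P K m)) :
    verdict P K pk T x θ b b' = verdict P K pk T x' θ' b b' := by
  have : ∀ com o, accepts K pk x θ com T.1 o ↔ accepts K pk x' θ' com T.1 o := fun com o =>
    forall₂_congr fun i hi => by rw [hx hi, hθ hi]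
  unfold verdict
  split <;> simp_all

/-- The coins of the reduction: a key, a test set, and the strings for the test set. -/
abbrev Coins (K : Commitment) (m n : ℕ) : Type := K.Key × TestSet m n × Bits m × Bits m

/-- The distribution of the coins of the reduction. -/
def coinLaw (K : Commitment) (h : n ≤ m) : PMF (Coins K m n) :=
  haveI := TestSet.nonempty h
  K.keyGen.bind fun pk => (PMF.uniformOfFintype (TestSet m n)).bind fun T =>
    (PMF.uniformOfFintype (Bits m)).bind fun x => (PMF.uniformOfFintype (Bits m)).map fun θ =>
      (pk, T, x, θ)

/-- The verification phase with simulated Alice, on `m` qubits. The outcome contains a flag that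
is set if the verification fails. -/
def Adversary.verify (B : Adversary (P.compile K m h)) :
    Instrument ((B.Z × P.Ω) × Coins K m n) (Bits B.v × Bits m) (B.C 2 × Bool)
      (Bits (B.q 2)) :=
  ((((B.prep.relabel (fun k : (B.Z × P.Ω) × Coins K m n => (k.1.1, (k.1.2, k.2.1)))
      fun k c => (k.2, c)).comp
    ((B.send 0).relabel Prod.snd fun k d => (k.1, d))).comp
    ((B.recv 0).relabel
      (fun k : Coins K m n × B.C' 0 × Option (CompiledMB P K m) =>
        (k.2.1, testReply P K k.1.2.1 k.2.2))
      fun k c => (k.1, k.2.2, c))).comp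
    ((B.send 1).relabel (fun k => k.2.2) fun k d => (k.1, k.2.1, d))).comp
    ((B.recv 1).relabel
      (fun k : Coins K m n × Option (CompiledMB P K m) × B.C' 1 × Option (CompiledMB P K m) =>
        (k.2.2.1, verdictReply P m
          (verdict P K k.1.1 k.1.2.1 k.1.2.2.1 k.1.2.2.2 k.2.1 k.2.2.2)))
      fun k c => (c, !verdict P K k.1.1 k.1.2.1 k.1.2.2.1 k.1.2.2.2 k.2.1 k.2.2.2))

/-- The preparation of the reduction: the qubits for the test set are inserted and the
verification phase is simulated. -/
def Adversary.reducePrep (B : Adversary (P.compile K m h)) :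
    Instrument (B.Z × P.Ω) (Bits B.v × Bits n) (B.C 2 × Bool) (Bits (B.q 2)) :=
  (((Instrument.sample (Bits B.v × Bits n) fun _ : B.Z × P.Ω => coinLaw K h).relabel id
      fun k r => (k, r)).comp
    ((Instrument.ofIsometry (fun r : Coins K m n =>
        Matrix.kroneckerMap (· * ·) (1 : Matrix (Bits B.v) (Bits B.v) ℂ)
          (r.2.1.insert r.2.2.1 r.2.2.2)) fun r => by
        rw [Matrix.conjTranspose_kronecker, ← Matrix.mul_kronecker_mul,
          TestSet.insert_isometry, Matrix.conjTranspose_one, Matrix.one_mul,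
          Matrix.one_kronecker_one]).relabel Prod.snd
      fun k _ => k)).comp B.verify

/-- The adversary against the original protocol that emulates an adversary against the compiled
protocol. If the simulated verification fails, he aborts in the first round. -/
def Adversary.reduce (B : Adversary (P.compile K m h)) : Adversary P where
  Z := B.Z
  v := B.v
  y := B.y
  C := fun j => B.C (j + 2) × Bool
  C' := fun j => B.C' (j + 2) × Bool
  q := fun j => B.q (j + 2)
  q' := fun j => B.q' (j + 2)
  prep := B.reducePrep
  send := fun j => (B.send (j + 2)).relabel Prod.fst
    fun k d => ((d.1, k.2), stripMessage P K m k.2 d.2)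
  recv := fun j => (B.recv (j + 2)).relabel
    (fun k => (k.1.1, k.2.map fun a => .inr (.inr a))) fun k c => (c, k.1.2)
  final := B.final.relabel (fun k : B.C (P.rounds + 2) × Bool => k.1) fun _ l => l

variable {N : Type} [AddCommGroup N] [Module ℂ N]

/-- The continuation of the verification phase with simulated Alice. -/
def Adversary.verifyPull (B : Adversary (P.compile K m h)) (z : B.Z) (ω : P.Ω) (pk : K.Key)
    (T : TestSet m n) (x θ : Bits m)
    (G : B.C 2 → Bool → (Matrix (Bits (B.q 2)) (Bits (B.q 2)) ℂ →ₗ[ℂ] N)) :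
    Matrix (Bits B.v × Bits m) (Bits B.v × Bits m) ℂ →ₗ[ℂ] N :=
  B.prep.pull (z, (ω, pk)) fun c₀ => (B.send 0).pull c₀ fun d =>
    (B.recv 0).pull (d.1, testReply P K T d.2) fun c₁ => (B.send 1).pull c₁ fun e =>
      (B.recv 1).pull (e.1, verdictReply P m (verdict P K pk T x θ d.2 e.2)) fun c₂ =>
        G c₂ (!verdict P K pk T x θ d.2 e.2)

/-- The simulated Alice knows only the inserted strings, yet reaches the verdict of an Alice who
knows the complete merged strings, since the two agree on `T`. -/
theorem Adversary.verifyPull_merge (B : Adversary (P.compile K m h)) (z : B.Z) (ω : P.Ω)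
    (pk : K.Key) (T : TestSet m n) (x θ : Bits n) (x' θ' : Bits m)
    (G : B.C 2 → Bool → (Matrix (Bits (B.q 2)) (Bits (B.q 2)) ℂ →ₗ[ℂ] N)) :
    B.verifyPull z ω pk T (T.merge x x') (T.merge θ θ') G = B.verifyPull z ω pk T x' θ' G := by
  have hv : verdict P K pk T (T.merge x x') (T.merge θ θ') = verdict P K pk T x' θ' :=
    funext₂ <| verdict_congr pk T (fun _ => T.merge_of_mem x x') fun _ => T.merge_of_mem θ θ'
  rw [Adversary.verifyPull, hv]
  rfl

theorem Adversary.pull_verify (B : Adversary (P.compile K m h)) (k : (B.Z × P.Ω) × Coins K m n)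
    (G : B.C 2 × Bool → (Matrix (Bits (B.q 2)) (Bits (B.q 2)) ℂ →ₗ[ℂ] N)) :
    B.verify.pull k G = B.verifyPull k.1.1 k.1.2 k.2.1 k.2.2.1 k.2.2.2.1 k.2.2.2.2
      fun c f => G (c, f) := by
  unfold Adversary.verify Adversary.verifyPull
  rw [Instrument.pull_comp, Instrument.pull_comp, Instrument.pull_comp, Instrument.pull_comp]
  refine (Instrument.pull_relabel ..).trans (Instrument.pull_congr _ _ fun c₀ => ?_)
  refine (Instrument.pull_relabel ..).trans (Instrument.pull_congr _ _ fun d => ?_)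
  refine (Instrument.pull_relabel ..).trans (Instrument.pull_congr _ _ fun c₁ => ?_)
  refine (Instrument.pull_relabel ..).trans (Instrument.pull_congr _ _ fun e => ?_)
  exact Instrument.pull_relabel ..

/-- For fixed coins, the inserted register is the BB84 state of the merged strings and the verdict
is the one for these strings, so `B` sees a genuine verification phase. -/
theorem Adversary.pull_reducePrep (B : Adversary (P.compile K m h)) (z : B.Z) (ω : P.Ω)
    (G : B.C 2 × Bool → (Matrix (Bits (B.q 2)) (Bits (B.q 2)) ℂ →ₗ[ℂ] N))
    (ρ : Matrix (Bits B.v) (Bits B.v) ℂ) (x θ : Bits n) :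
    B.reducePrep.pull (z, ω) G (Matrix.kroneckerMap (· * ·) ρ (bb84State x θ)) =
      expect (coinLaw K h) fun r =>
        B.verifyPull z ω r.1 r.2.1 (r.2.1.merge x r.2.2.1) (r.2.1.merge θ r.2.2.2)
          (fun c f => G (c, f)) (Matrix.kroneckerMap (· * ·) ρ
            (bb84State (r.2.1.merge x r.2.2.1) (r.2.1.merge θ r.2.2.2))) := by
  unfold Adversary.reducePrep
  rw [Instrument.pull_comp, Instrument.pull_comp, Instrument.pull_relabel, Instrument.pull_sample,
    expect_apply]
  refine expect_congr _ fun r => ?_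
  rw [Instrument.pull_relabel, Instrument.pull_ofIsometry, B.pull_verify, B.verifyPull_merge]
  congr 1
  rw [Matrix.conjTranspose_kronecker, ← Matrix.mul_kronecker_mul, ← Matrix.mul_kronecker_mul,
    TestSet.insert_bb84State, Matrix.conjTranspose_one, Matrix.one_mul, Matrix.mul_one]

/-! ### Alice's reactions in the original and the compiled protocol -/

theorem expect_kernelA_none {U X : Type} {n : ℕ} {P : Protocol U X n} (b : Option P.MB)
    (G : Option P.SA × Option P.MA → N) : expect (P.kernelA none b) G = G (none, none) := by
  have : P.kernelA none b = PMF.pure (none, none) := by cases b <;> rfl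
  rw [this, expect_pure]

theorem expect_kernelA_abort {U X : Type} {n : ℕ} {P : Protocol U X n} (s : Option P.SA)
    (G : Option P.SA × Option P.MA → N) : expect (P.kernelA s none) G = G (none, none) := by
  have : P.kernelA s none = PMF.pure (none, none) := by cases s <;> rfl
  rw [this, expect_pure]

theorem expect_kernelA_some {U X : Type} {n : ℕ} {P : Protocol U X n} (s : P.SA) (b : P.MB)
    (G : Option P.SA × Option P.MA → N) :
    expect (P.kernelA (some s) (some b)) G =
      expect (P.stepA s b) fun r => G (r.map Prod.fst, r.map Prod.snd) :=
  expect_map _ _ _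

/-- The value of `e` at `(some s, true)` is left free: when the flag is set Bob aborts, so after the
round Alice's state is `none` whatever it was before. -/
theorem expect_kernelA_compile (e : Option P.SA → Bool → Option (CompiledSA P K m))
    (he : ∀ f, e none f = none) (he' : ∀ s, e (some s) false = some (.inr (.inr s)))
    (s : Option P.SA) (f : Bool) (b : Option (CompiledMB P K m))
    (G : Option (CompiledSA P K m) × Option (CompiledMA P m) → N) :
    (expect (P.kernelA s (stripMessage P K m f b)) fun r =>
      G (e r.1 f, r.2.map fun a => .inr (.inr a))) =
    expect ((P.compile K m h).kernelA (liftState P K m s f) b) G := by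
  cases s with
  | none =>
    rw [expect_kernelA_none, he]
    exact (expect_kernelA_none (P := P.compile K m h) b G).symm
  | some s =>
    cases f with
    | true =>
      have hs : stripMessage P K m true b = none := rfl
      rw [hs, expect_kernelA_abort, he]
      exact (expect_kernelA_none (P := P.compile K m h) b G).symm
    | false =>
      -- Commitments or openings sent at this stage are malformed: compiled Alice aborts on them,
      -- and `stripMessage` turns them into an abort by Bob.
      rcases b with _ | com | o | b
      · refine (expect_kernelA_abort _ _).trans ?_
        rw [he]
        exact (expect_kernelA_abort (P := P.compile K m h) _ G).symm
      · refine (expect_kernelA_abort _ _).trans ?_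
        rw [he]
        exact ((expect_kernelA_some (P := P.compile K m h) (.inr (.inr s)) (.inl com) G).trans
          (expect_pure _ _)).symm
      · refine (expect_kernelA_abort _ _).trans ?_
        rw [he]
        exact ((expect_kernelA_some (P := P.compile K m h) (.inr (.inr s)) (.inr (.inl o)) G).trans
          (expect_pure _ _)).symm
      · refine (expect_kernelA_some s b _).trans (Eq.trans ?_
          ((expect_kernelA_some (P := P.compile K m h) (.inr (.inr s)) (.inr (.inr b)) G).trans
            (expect_map (P.stepA s b) _ _)).symm)
        refine expect_congr _ fun r => ?_
        cases r with
        | none =>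
          simp only [Option.map_none, he]
          rfl
        | some r =>
          simp only [Option.map_some, he']
          rfl

/-- A round of the post-processing is the same in both protocols; `e` is any identification of
Alice's states that agrees with `liftState` on rounds that follow a successful verification. -/
theorem Adversary.reduce_roundPull (B : Adversary (P.compile K m h)) (j : ℕ)
    (e : Option P.SA → Bool → Option (CompiledSA P K m)) (he : ∀ f, e none f = none)
    (he' : ∀ s, e (some s) false = some (.inr (.inr s)))
    (G : Option (CompiledSA P K m) → B.C (j + 3) →
      (Matrix (Bits (B.q (j + 3))) (Bits (B.q (j + 3))) ℂ →ₗ[ℂ] N))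
    (s : Option P.SA) (c : B.C (j + 2)) (f : Bool) :
    B.reduce.roundPull j (fun s c => G (e s c.2) c.1) s (c, f) =
      B.roundPull (j + 2) G (liftState P K m s f) c := by
  unfold Adversary.roundPull
  refine (Instrument.pull_relabel ..).trans (Instrument.pull_congr _ _ fun d => ?_)
  refine (expect_congr (G' := fun r => (B.recv (j + 2)).pull
    (d.1, r.2.map fun a => .inr (.inr a)) fun c' => G (e r.1 f) c') _ fun r =>
      Instrument.pull_relabel ..).trans ?_
  exact expect_kernelA_compile e he he' s f d.2 fun r =>
    (B.recv (j + 2)).pull (d.1, r.2) fun c' => G r.1 c'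

/-- Alice's state after the commitments. -/
def afterTest (P : Protocol U X n) (K : Commitment)
    (w : (P.Ω × K.Key) × U × Bits m × Bits m) (T : TestSet m n) :
    Option (CompiledMB P K m) → Option (CompiledSA P K m)
  | some (.inl com) => some (.inr (.inl (w, com, T)))
  | _ => none

/-- Alice's reaction to the commitments. -/
theorem expect_kernelA_commit (w : (P.Ω × K.Key) × U × Bits m × Bits m)
    (b : Option (CompiledMB P K m))
    (G : Option (CompiledSA P K m) × Option (CompiledMA P m) → N) :
    haveI := TestSet.nonempty h
    expect ((P.compile K m h).kernelA (some (.inl w)) b) G =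
      expect (PMF.uniformOfFintype (TestSet m n)) fun T =>
        G (afterTest P K w T b, testReply P K T b) := by
  have := TestSet.nonempty h
  rcases b with _ | com | o | b
  · exact (expect_kernelA_abort (P := P.compile K m h) _ G).trans (expect_const _ _).symm
  · exact (expect_kernelA_some (P := P.compile K m h) (.inl w) (.inl com) G).trans
      (expect_map _ _ _)
  · exact ((expect_kernelA_some (P := P.compile K m h) (.inl w) (.inr (.inl o)) G).trans
      (expect_pure _ _)).trans (expect_const _ _).symm
  · exact ((expect_kernelA_some (P := P.compile K m h) (.inl w) (.inr (.inr b)) G).trans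
      (expect_pure _ _)).trans (expect_const _ _).symm

/-- Alice's reaction to the openings, with the state for the post-processing drawn even if the
verification fails. -/
theorem expect_kernelA_open (ω : P.Ω) (pk : K.Key) (u : U) (x θ : Bits m) (T : TestSet m n)
    (b b' : Option (CompiledMB P K m))
    (G : Option (CompiledSA P K m) × Option (CompiledMA P m) → N) :
    expect ((P.compile K m h).kernelA (afterTest P K ((ω, pk), u, x, θ) T b) b') G =
      expect (P.initA ω u (T.restrict x) (T.restrict θ)) fun s =>
        G (liftState P K m (some s) (!verdict P K pk T x θ b b'),
          verdictReply P m (verdict P K pk T x θ b b')) := by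
  classical
  by_cases hb : ∃ com, b = some (.inl com)
  · obtain ⟨com, rfl⟩ := hb
    rcases b' with _ | com' | o | b'
    · exact (expect_kernelA_abort (P := P.compile K m h) _ G).trans (expect_const _ _).symm
    · exact ((expect_kernelA_some (P := P.compile K m h)
        (.inr (.inl (((ω, pk), u, x, θ), com, T))) (.inl com') G).trans
        (expect_pure _ _)).trans (expect_const _ _).symm
    · refine (expect_kernelA_some (P := P.compile K m h)
        (.inr (.inl (((ω, pk), u, x, θ), com, T))) (.inr (.inl o)) G).trans ?_
      by_cases hacc : accepts K pk x θ com T.1 o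
      · have h₁ : (P.compile K m h).stepA (.inr (.inl (((ω, pk), u, x, θ), com, T))) (.inr (.inl o))
            = (P.initA ω u (T.restrict x) (T.restrict θ)).map fun s =>
                some (.inr (.inr s), .inr (.inl ())) := if_pos hacc
        have h₂ : verdict P K pk T x θ (some (.inl com)) (some (.inr (.inl o))) = true := by
          simpa [verdict] using hacc
        rw [h₁, h₂]
        exact expect_map _ _ _
      · have h₁ : (P.compile K m h).stepA (.inr (.inl (((ω, pk), u, x, θ), com, T))) (.inr (.inl o))
            = PMF.pure none := if_neg hacc
        have h₂ : verdict P K pk T x θ (some (.inl com)) (some (.inr (.inl o))) = false := by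
          simpa [verdict] using hacc
        rw [h₁, h₂]
        -- After a rejection `liftState` is `none` for every `s`, so the superfluous draw of `s`
        -- integrates out.
        exact (expect_pure _ _).trans (expect_const _ _).symm
    · exact ((expect_kernelA_some (P := P.compile K m h)
        (.inr (.inl (((ω, pk), u, x, θ), com, T))) (.inr (.inr b')) G).trans
        (expect_pure _ _)).trans (expect_const _ _).symm
  · have h₁ : afterTest P K ((ω, pk), u, x, θ) T b = none := by
      unfold afterTest
      split <;> simp_all
    have h₂ : verdict P K pk T x θ b b' = false := by
      unfold verdict
      split <;> simp_all
    rw [h₁, h₂]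
    exact (expect_kernelA_none (P := P.compile K m h) b' G).trans (expect_const _ _).symm

/-- The two rounds of the verification phase. -/
theorem Adversary.verification_rounds (B : Adversary (P.compile K m h)) (u : U) (z : B.Z)
    (ω : P.Ω) (pk : K.Key) (x θ : Bits m)
    (G : Option (CompiledSA P K m) → B.C 2 →
      (Matrix (Bits (B.q 2)) (Bits (B.q 2)) ℂ →ₗ[ℂ] N)) :
    haveI := TestSet.nonempty h
    (B.prep.pull (z, (ω, pk)) fun c =>
      B.roundPull 0 (B.roundPull 1 G) (some (.inl ((ω, pk), u, x, θ))) c) =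
    expect (PMF.uniformOfFintype (TestSet m n)) fun T =>
      expect (P.initA ω u (T.restrict x) (T.restrict θ)) fun s =>
        B.verifyPull z ω pk T x θ fun c f => G (liftState P K m (some s) f) c := by
  have := TestSet.nonempty h
  unfold Adversary.verifyPull
  simp only [← Instrument.pull_expect]
  refine Instrument.pull_congr _ _ fun c₀ => Instrument.pull_congr _ _ fun d => ?_
  refine (expect_kernelA_commit ((ω, pk), u, x, θ) d.2 fun r =>
    (B.recv 0).pull (d.1, r.2) fun c' => B.roundPull 1 G r.1 c').trans (expect_congr _ fun T => ?_)
  refine Instrument.pull_congr _ _ fun c₁ => Instrument.pull_congr _ _ fun e => ?_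
  -- The rewriting above pushed the draw of `s` past `B.recv 1` as well; it is brought back to
  -- Alice's turn.
  rw [Instrument.pull_expect]
  exact expect_kernelA_open ω pk u x θ T d.2 e.2 fun r =>
    (B.recv 1).pull (e.1, r.2) fun c' => G r.1 c'

-- The reduction draws `T` and its strings after Alice's `n`-bit strings and state, whereas compiled
-- Alice draws `m`-bit strings, then `T`, then her state from the restrictions. The joint laws
-- agree: all draws except that of `s` are mutually independent, and for fixed `T` merging preserves
-- uniformity.
omit [Fintype U] in
theorem expect_coinLaw {S : Type} [Fintype S] (q : Bits n → Bits n → PMF S)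
    (Φ : S → K.Key → TestSet m n → Bits m → Bits m → N) :
    haveI := TestSet.nonempty h
    (expect (PMF.uniformOfFintype (Bits n)) fun x => expect (PMF.uniformOfFintype (Bits n)) fun θ =>
      expect (q x θ) fun s => expect (coinLaw K h) fun r =>
        Φ s r.1 r.2.1 (r.2.1.merge x r.2.2.1) (r.2.1.merge θ r.2.2.2)) =
    expect K.keyGen fun pk => expect (PMF.uniformOfFintype (Bits m)) fun y =>
      expect (PMF.uniformOfFintype (Bits m)) fun η =>
        expect (PMF.uniformOfFintype (TestSet m n)) fun T =>
          expect (q (T.restrict y) (T.restrict η)) fun s => Φ s pk T y η := by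
  have := TestSet.nonempty h
  calc _ = expect (coinLaw K h) fun r => expect (PMF.uniformOfFintype (Bits n)) fun x =>
        expect (PMF.uniformOfFintype (Bits n)) fun θ => expect (q x θ) fun s =>
          Φ s r.1 r.2.1 (r.2.1.merge x r.2.2.1) (r.2.1.merge θ r.2.2.2) := by
        rw [expect_comm (coinLaw K h)]
        refine expect_congr _ fun x => ?_
        rw [expect_comm (coinLaw K h)]
        refine expect_congr _ fun θ => ?_
        rw [expect_comm (coinLaw K h)]
    _ = expect K.keyGen fun pk => expect (PMF.uniformOfFintype (TestSet m n)) fun T =>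
          expect (PMF.uniformOfFintype (Bits m)) fun y =>
            expect (PMF.uniformOfFintype (Bits m)) fun η =>
              expect (q (T.restrict y) (T.restrict η)) fun s => Φ s pk T y η := by
        rw [coinLaw, expect_bind]
        refine expect_congr _ fun pk => ?_
        rw [expect_bind]
        refine expect_congr _ fun T => ?_
        rw [expect_bind]
        simp only [expect_map]
        -- The draw of `s` depends on `x` and `θ` jointly and stays innermost; `T.expect_merge` is
        -- then applied to the bits and to the bases in turn.
        let Ψ : Bits n → Bits m → Bits n → Bits m → N := fun x y θ η =>
          expect (q x θ) fun s => Φ s pk T y η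
        refine Eq.trans ?_ (T.expect_merge fun x y =>
          expect (PMF.uniformOfFintype (Bits m)) fun η => Ψ x y (T.restrict η) η)
        rw [expect_comm (PMF.uniformOfFintype (Bits n)) (PMF.uniformOfFintype (Bits m))]
        refine expect_congr _ fun x' => ?_
        rw [expect_comm (PMF.uniformOfFintype (Bits m)) (PMF.uniformOfFintype (Bits n))]
        refine expect_congr _ fun x => ?_
        refine Eq.trans ?_ (T.expect_merge fun θ η => Ψ x (T.merge x x') θ η)
        rw [expect_comm (PMF.uniformOfFintype (Bits m)) (PMF.uniformOfFintype (Bits n))]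
    _ = _ := by
        refine expect_congr _ fun pk => ?_
        rw [expect_comm (PMF.uniformOfFintype (TestSet m n))]
        refine expect_congr _ fun x => ?_
        rw [expect_comm (PMF.uniformOfFintype (TestSet m n))]

/-! ### Equality of the two executions -/

theorem Adversary.sum_verified (B : Adversary (P.compile K m h)) (u : U) (z : B.Z)
    (ρ : Matrix (Bits B.v) (Bits B.v) ℂ)
    (G : Option (CompiledSA P K m) → B.C 2 →
      (Matrix (Bits (B.q 2)) (Bits (B.q 2)) ℂ →ₗ[ℂ] N)) :
    haveI := TestSet.nonempty h
    ∑ s, ∑ c, G s c (B.stateAt u z ρ 2 s c) =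
      expect P.crs fun ω => expect K.keyGen fun pk => expect (PMF.uniformOfFintype (Bits m)) fun x =>
        expect (PMF.uniformOfFintype (Bits m)) fun θ =>
          expect (PMF.uniformOfFintype (TestSet m n)) fun T =>
            expect (P.initA ω u (T.restrict x) (T.restrict θ)) fun s =>
              B.verifyPull z ω pk T x θ (fun c f => G (liftState P K m (some s) f) c)
                (Matrix.kroneckerMap (· * ·) ρ (bb84State x θ)) := by
  have := TestSet.nonempty h
  refine (B.sum_roundMap 1 G _).trans ((B.sum_roundMap 0 _ _).trans
    ((B.sum_prepState u z ρ _).trans ((expect_bind _ _ _).trans (expect_congr _ fun ω => ?_))))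
  refine (expect_map _ _ _).trans (expect_congr _ fun pk => expect_congr _ fun x =>
    expect_congr _ fun θ => (expect_pure _ _).trans ?_)
  refine (LinearMap.congr_fun (B.verification_rounds u z ω pk x θ G) _).trans ?_
  rw [expect_apply]
  exact expect_congr _ fun T => expect_apply _ _ _

/-- After the verification, the joint state in the compiled protocol is the one that the
reduction produces in the preparation phase of the original protocol. -/
theorem Adversary.sum_stateAt_two (B : Adversary (P.compile K m h)) (u : U) (z : B.Z)
    (ρ : Matrix (Bits B.v) (Bits B.v) ℂ)
    (G : Option (CompiledSA P K m) → B.C 2 →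
      (Matrix (Bits (B.q 2)) (Bits (B.q 2)) ℂ →ₗ[ℂ] N)) :
    ∑ s, ∑ c, G s c (B.stateAt u z ρ 2 s c) =
      ∑ s, ∑ c : B.C 2 × Bool, G (liftState P K m s c.2) c.1 (B.reduce.stateAt u z ρ 0 s c) := by
  refine Eq.trans ?_ (B.reduce.sum_prepState u z ρ
    fun s (c : B.C 2 × Bool) => G (liftState P K m s c.2) c.1).symm
  refine (B.sum_verified u z ρ G).trans (expect_congr _ fun ω => ?_)
  -- The honest `m`-bit strings are resampled as Alice's `n`-bit strings merged with the reduction's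
  -- test data.
  refine (expect_coinLaw (h := h) (P.initA ω u) fun s pk T y η =>
    B.verifyPull z ω pk T y η (fun c f => G (liftState P K m (some s) f) c)
      (Matrix.kroneckerMap (· * ·) ρ (bb84State y η))).symm.trans ?_
  exact expect_congr _ fun x => expect_congr _ fun θ => expect_congr _ fun s =>
    (B.pull_reducePrep z ω (fun c => G (liftState P K m (some s) c.2) c.1) ρ x θ).symm

/-- The freedom in `e` serves two purposes: `e = liftState` propagates the invariant, while an `e`
that ignores the flag makes Alice's final output comparable. -/
theorem Adversary.sum_stateAt_succ (B : Adversary (P.compile K m h)) (u : U) (z : B.Z)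
    (ρ : Matrix (Bits B.v) (Bits B.v) ℂ) (j : ℕ)
    (e : Option P.SA → Bool → Option (CompiledSA P K m)) (he : ∀ f, e none f = none)
    (he' : ∀ s, e (some s) false = some (.inr (.inr s)))
    (hj : ∀ G : Option (CompiledSA P K m) → B.C (j + 2) →
        (Matrix (Bits (B.q (j + 2))) (Bits (B.q (j + 2))) ℂ →ₗ[ℂ] N),
      ∑ s, ∑ c, G s c (B.stateAt u z ρ (j + 2) s c) =
        ∑ s, ∑ c : B.C (j + 2) × Bool,
          G (liftState P K m s c.2) c.1 (B.reduce.stateAt u z ρ j s c))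
    (G : Option (CompiledSA P K m) → B.C (j + 3) →
      (Matrix (Bits (B.q (j + 3))) (Bits (B.q (j + 3))) ℂ →ₗ[ℂ] N)) :
    ∑ s, ∑ c, G s c (B.stateAt u z ρ (j + 3) s c) =
      ∑ s, ∑ c : B.C (j + 3) × Bool, G (e s c.2) c.1 (B.reduce.stateAt u z ρ (j + 1) s c) := by
  refine (B.sum_roundMap (j + 2) G _).trans ((hj _).trans ?_)
  refine Eq.trans ?_ (B.reduce.sum_roundMap j
    (fun s (c : B.C (j + 3) × Bool) => G (e s c.2) c.1) _).symm
  refine Finset.sum_congr rfl fun s _ => Finset.sum_congr rfl fun c _ => ?_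
  exact (LinearMap.congr_fun (B.reduce_roundPull j e he he' G s c.1 c.2) _).symm

theorem Adversary.sum_stateAt (B : Adversary (P.compile K m h)) (u : U) (z : B.Z)
    (ρ : Matrix (Bits B.v) (Bits B.v) ℂ) (j : ℕ)
    (G : Option (CompiledSA P K m) → B.C (j + 2) →
      (Matrix (Bits (B.q (j + 2))) (Bits (B.q (j + 2))) ℂ →ₗ[ℂ] N)) :
    ∑ s, ∑ c, G s c (B.stateAt u z ρ (j + 2) s c) =
      ∑ s, ∑ c : B.C (j + 2) × Bool,
        G (liftState P K m s c.2) c.1 (B.reduce.stateAt u z ρ j s c) := by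
  induction j with
  | zero => exact B.sum_stateAt_two u z ρ G
  | succ j ih =>
    exact B.sum_stateAt_succ u z ρ j (liftState P K m) (fun f => rfl) (fun s => rfl) ih G

theorem Adversary.realOut_eq {U X : Type} {n : ℕ} {P : Protocol U X n} (B : Adversary P) (u : U)
    (z : B.Z) (ρ : Matrix (Bits B.v) (Bits B.v) ℂ) (x : Option X) :
    B.realOut u z ρ x = ∑ s, ∑ c, (prob (P.outputA s) x • B.final.branchMap c ())
      (B.stateAt u z ρ P.rounds s c) := by
  simp only [Adversary.realOut, Instrument.apply, Finset.smul_sum]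
  rfl

theorem Instrument.branch_relabel {K K' I L J : Type} [Fintype I] [DecidableEq I] [Fintype L]
    [Fintype J] [DecidableEq J] (E : Instrument K I L J) (g : K' → K) (k : K') (l : L)
    (ρ : Matrix I I ℂ) : (E.relabel g fun _ l => l).branch k l ρ = E.branch (g k) l ρ := by
  classical
  -- The continuation that keeps outcome `l` and discards all others isolates a single branch.
  have := LinearMap.congr_fun (E.pull_relabel g (fun _ l => l) k
    fun l' => if l' = l then (LinearMap.id : Matrix J J ℂ →ₗ[ℂ] Matrix J J ℂ) else 0) ρ
  simp only [pull_apply] at this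
  simpa [Finset.sum_ite, ite_apply, apply_ite, DFunLike.ite_apply] using this

/-- The reduction has the same output as the adversary that it emulates. -/
theorem Adversary.realOut_reduce (B : Adversary (P.compile K m h)) (u : U) (z : B.Z)
    (ρ : Matrix (Bits B.v) (Bits B.v) ℂ) : B.reduce.realOut u z ρ = B.realOut u z ρ := by
  funext x
  refine (B.reduce.realOut_eq u z ρ x).trans (Eq.trans ?_ (B.realOut_eq u z ρ x).symm)
  have hfin : ∀ c (τ : Matrix (Bits (B.q (P.rounds + 2))) (Bits (B.q (P.rounds + 2))) ℂ),
      B.reduce.final.branch c () τ = B.final.branch c.1 () τ :=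
    fun c τ => Instrument.branch_relabel B.final _ c () τ
  have hr := P.rounds_pos
  -- Alice's output depends on her state but not on Bob's flag, so the identification of states must
  -- ignore the flag. That is legitimate only once a round has passed, hence `0 < r` below.
  let e : Option P.SA → Bool → Option (CompiledSA P K m) := fun s _ => s.map fun s => .inr (.inr s)
  have key : ∀ r (_ : 0 < r) (G : Option (CompiledSA P K m) → B.C (r + 2) →
      (Matrix (Bits (B.q (r + 2))) (Bits (B.q (r + 2))) ℂ →ₗ[ℂ]
        Matrix (Bits B.y) (Bits B.y) ℂ)),
      ∑ s, ∑ c, G s c (B.stateAt u z ρ (r + 2) s c) =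
        ∑ s, ∑ c : B.C (r + 2) × Bool, G (e s c.2) c.1 (B.reduce.stateAt u z ρ r s c) := by
    intro r hr G
    obtain ⟨j, rfl⟩ := Nat.exists_eq_succ_of_ne_zero hr.ne'
    exact B.sum_stateAt_succ u z ρ j e (fun f => rfl) (fun s => rfl) (B.sum_stateAt u z ρ j) G
  refine Eq.trans ?_ (key P.rounds hr fun s c =>
    prob ((P.compile K m h).outputA s) x • B.final.branchMap c ()).symm
  refine Finset.sum_congr rfl fun s _ => Finset.sum_congr rfl fun c _ => ?_
  have hout : (P.compile K m h).outputA (e s c.2) = P.outputA s := by cases s <;> rfl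
  simp only [LinearMap.smul_apply, Instrument.branchMap_apply]
  rw [hout]
  exact congrArg _ (hfin c _)

/-! ### Storage bound and conclusion -/

theorem Adversary.isBQSM_reduce (B : Adversary (P.compile K m h)) {γ γ' : ℝ}
    (hγ : γ' * m ≤ γ * n) (hB : B.IsBQSM γ') : B.reduce.IsBQSM γ :=
  ⟨fun j h₁ h₂ => (hB.1 (j + 2) (Nat.add_le_add_right h₁ 2) (Nat.add_le_add_right h₂ 2)).trans hγ,
    fun j h₁ h₂ => (hB.2 (j + 2) (Nat.add_le_add_right h₁ 2) (Nat.add_lt_add_right h₂ 2)).trans hγ⟩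

end Reduction

/-- Rounding `m` down is the favourable direction: the allowance `γ (1 - α) m` then never exceeds `γ
n`. -/
theorem compiledQubits_mul_le {α : ℝ} (h1 : α < 1) (n : ℕ) :
    (1 - α) * compiledQubits α n ≤ n := by
  have h : 0 < 1 - α := sub_pos.mpr h1
  have := Nat.floor_le (div_nonneg (Nat.cast_nonneg (α := ℝ) n) h.le)
  rw [mul_comm, ← le_div_iff₀ h]
  exact this

end BQSM

end

theorem mainTheorem2
    (F : ℕ → BQSM.Functionality)
    (P : ∀ n : ℕ, BQSM.Protocol (F n).U (F n).X n)
    (K : ℕ → BQSM.Commitment)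
    (γ α : ℝ) (hγ0 : 0 < γ) (hγ1 : γ < 1) (hα0 : 0 < α) (hα1 : α < 1)
    (hP : BQSM.SecureAgainstBQSM F P γ) :
    BQSM.SecureAgainstBQSM F (BQSM.compiled P K α hα0 hα1) (γ * (1 - α)) := by
  intro B hB
  have hB' : ∀ n, BQSM.Adversary.IsBQSM
      (BQSM.Adversary.reduce (P := P n) (K := K n) (h := BQSM.le_compiledQubits hα0 hα1 n) (B n))
      γ := fun n => BQSM.Adversary.isBQSM_reduce (B n) (by
    rw [mul_assoc]
    exact mul_le_mul_of_nonneg_left (BQSM.compiledQubits_mul_le hα1 n) hγ0.le) (hB n)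
  obtain ⟨B', h⟩ := hP _ hB'
  -- `B.reduce` has by definition the same `Z`, `v` and `y` as `B`, so the ideal adversary and the
  -- input states carry over unchanged.
  refine ⟨B', fun inp => ?_⟩
  have hout : ∀ n, (BQSM.Adversary.reduce (P := P n) (K := K n)
      (h := BQSM.le_compiledQubits hα0 hα1 n) (B n)).realOut = (B n).realOut := fun n =>
    funext₃ fun u z ρ => BQSM.Adversary.realOut_reduce (P := P n) (K := K n)
      (h := BQSM.le_compiledQubits hα0 hα1 n) (B n) u z ρ
  have := h inp
  simp only [hout] at this
  exact this
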